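/- Let $c$ be a positive integer, $N=\{1,\dots,n\}$ a set of agents and $O$ a finite set of items. For $v:2^O\to\mathbb{R}$ write $\Delta_v(S,o)=v(S\cup\{o\})-v(S)$. The function $v$ is a $\{-1,0,c\}$-ONSUB (order-neutral submodular) valuation if 1. $v(\emptyset)=0$, and $\Delta_v(S,o)\ge\Delta_v(T,o)$ for all $S\subseteq T\subseteq O$ and $o\in O\setminus T$; 2. $\Delta_v(S,o)\in\{-1,0,c\}$ for all $S\subseteq O$ and $o\in O\setminus S$; 3. for every $S\subseteq O$, the vector of marginal gains $\bigl(\Delta_v(\{\pi(1),\dots,\pi(j-1)\},\pi(j))\bigr)_{j=1}^{|S|}$, sorted in ascending order, is the same for all orderings (bijections) $\pi:\{1,\dots,|S|\}\to S$. Suppose that each agent $i\in N$ has a $\{-1,0,c\}$-ONSUB valuation $v_i$. A complete allocation $X=(X_1,\dots,X_n)$ is a tuple of pairwise disjoint (possibly empty) bundles whose union is $O$. Its sorted utility vector $\vec s^{X}$ is the vector $(v_1(X_1),\dots,v_n(X_n))$ sorted in ascending order. A complete allocation $X$ is leximin if there is no complete allocation $Y$ such that, for some $k\in\{1,\dots,n\}$,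 $s^Y_j=s^X_j$ for all $j<k$ and $s^Y_k>s^X_k$. Then every leximin complete allocation $X$ is Lorenz dominating: for every complete allocation $Y$ and every $k\in\{1,\dots,n\}$, $$\sum_{j=1}^{k}s^X_j\ \ge\ \sum_{j=1}^{k}s^Y_j .$$ -/

import Mathlib

/-- The ascending rearrangement of a vector. -/
noncomputable def sortAsc {n : ℕ} (x : Fin n → ℝ) : Fin n → ℝ :=
  x ∘ Tuple.sort x

/-- `y` lexicographically dominates `z`. -/
def LexDominates {n : ℕ} (y z : Fin n → ℝ) : Prop :=
  ∃ k : Fin n, (∀ j : Fin n, j < k → y j = z j) ∧ z k < y k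

section Valuations

variable {O : Type*} [DecidableEq O]

/-- The marginal value `Δ_v(S, o) = v(S + o) - v(S)`. -/
def marginal (v : Finset O → ℝ) (S : Finset O) (o : O) : ℝ :=
  v (insert o S) - v S

/-- Normalized functions with decreasing marginal values. -/
def IsSubmodular (v : Finset O → ℝ) : Prop :=
  v ∅ = 0 ∧
    ∀ S T : Finset O, S ⊆ T → ∀ o : O, o ∉ T → marginal v T o ≤ marginal v S o

/-- Submodular functions all of whose marginal values lie in `A`. -/
def IsSub (A : Set ℝ) (v : Finset O → ℝ) : Prop :=
  IsSubmodular v ∧ ∀ (S : Finset O) (o : O), o ∉ S → marginal v S o ∈ A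

/-- The items of `S` that come strictly before position `j` in the ordering `π` of `S`. -/
def itemsBefore {S : Finset O} (π : Fin S.card ≃ S) (j : Fin S.card) : Finset O :=
  (Finset.univ.filter fun l : Fin S.card => l < j).image fun l => (π l : O)

/-- The marginal gains obtained when the items of `S` are added to the empty bundle one by one
in the order `π`, arranged in ascending order. -/
noncomputable def sortedTelescopingVector (v : Finset O → ℝ) (S : Finset O)
    (π : Fin S.card ≃ S) : Fin S.card → ℝ :=
  sortAsc fun j => marginal v (itemsBefore π j) (π j : O)

/-- The sorted telescoping sum vector of a bundle does not depend on the order of its items. -/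
def IsOrderNeutral (v : Finset O → ℝ) : Prop :=
  ∀ (S : Finset O) (π π' : Fin S.card ≃ S),
    sortedTelescopingVector v S π = sortedTelescopingVector v S π'

/-- Order-neutral submodular functions with marginal values in `A`. -/
def IsOnsub (A : Set ℝ) (v : Finset O → ℝ) : Prop :=
  IsSub A v ∧ IsOrderNeutral v

end Valuations

/-- An allocation of the items to `n` agents: pairwise disjoint (possibly empty) bundles.
Items that belong to no bundle are unallocated. -/
structure Allocation (n : ℕ) (O : Type*) where
  bundle : Fin n → Finset O
  disjoint : ∀ i j : Fin n, i ≠ j → Disjoint (bundle i) (bundle j)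

namespace Allocation

variable {n : ℕ} {O : Type*}

/-- No item is left unallocated. -/
def IsComplete (X : Allocation n O) : Prop :=
  ∀ o : O, ∃ i : Fin n, o ∈ X.bundle i

/-- The utility vector `(v_1(X_1), …, v_n(X_n))`. -/
def utility (v : Fin n → Finset O → ℝ) (X : Allocation n O) : Fin n → ℝ :=
  fun i => v i (X.bundle i)

/-- The utility vector sorted in ascending order. -/
noncomputable def sortedUtility (v : Fin n → Finset O → ℝ) (X : Allocation n O) : Fin n → ℝ :=
  sortAsc (X.utility v)

/-- `X` is a leximin (complete) allocation: the sorted utility vector of no complete allocation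
lexicographically dominates that of `X`. -/
def IsLeximin (v : Fin n → Finset O → ℝ) (X : Allocation n O) : Prop :=
  X.IsComplete ∧ ∀ Y : Allocation n O, Y.IsComplete →
    ¬ LexDominates (Y.sortedUtility v) (X.sortedUtility v)

/-- `X` is a Lorenz dominating (complete) allocation: for each `k`, the sum of its `k` smallest
utilities is at least that of every complete allocation. -/
def IsLorenzDominating (v : Fin n → Finset O → ℝ) (X : Allocation n O) : Prop :=
  X.IsComplete ∧ ∀ Y : Allocation n O, Y.IsComplete → ∀ k : Fin n,
    ∑ j ∈ Finset.Iic k, Y.sortedUtility v j ≤ ∑ j ∈ Finset.Iic k, X.sortedUtility v j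

end Allocation

/-! Order neutrality makes the number of marginals equal to `c`, and the number that are
nonnegative, functions of the bundle. They are matroid ranks `r` and `g`, with `v = c r + g - |S|`
(`IsOnsub.exists_rank`). A single complete allocation `Z` maximizes `∑ min(u_i, t)` over complete
allocations, for every integer `t` at once (`exists_truncation_dominating`). It is built from an
`r`-independent partial allocation `f` with optimal truncated sums (`exists_lorenz_partial`). A
maximum `g`-independent `G` preserves the ranks achieved by `f` (`exists_maximum_extension`). Items
left over by `G` are charged at most 1 each, and these charges are spread over the richest agents
(`exists_balanced_decrement`). At a given `t`, either the charges are invisible and optimality of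
`f` decides, or every charged value is at most `t` and only the total matters. Truncated sums
control sums of smallest utilities (`sum_Iic_sortAsc_le`), so `Z` is Lorenz dominating; a leximin
`X` must then have the same sorted vector. -/

/-! ### Matroid rank functions. -/

section MatroidRank

variable {O : Type*} [DecidableEq O]

/-- Normalized set functions with marginals `0` or `1` whose zero marginals persist:
the rank functions of matroids. -/
structure IsMatroidRank (r : Finset O → ℕ) : Prop where
  empty : r ∅ = 0
  step : ∀ S o, o ∉ S → r (insert o S) = r S ∨ r (insert o S) = r S + 1
  closure : ∀ S T, S ⊆ T → ∀ o, o ∉ T → r (insert o S) = r S → r (insert o T) = r T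

namespace IsMatroidRank

variable {r : Finset O → ℕ}

theorem le_insert (hr : IsMatroidRank r) (S : Finset O) (o : O) : r S ≤ r (insert o S) := by
  by_cases h : o ∈ S
  · rw [Finset.insert_eq_of_mem h]
  · rcases hr.step S o h with h | h <;> omega

theorem le_union (hr : IsMatroidRank r) (S T : Finset O) : r S ≤ r (S ∪ T) := by
  induction T using Finset.induction_on with
  | empty => simp
  | insert o T _ ih =>
    rw [Finset.union_insert]
    exact ih.trans (hr.le_insert _ _)

theorem mono (hr : IsMatroidRank r) {S T : Finset O} (h : S ⊆ T) : r S ≤ r T := by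
  have := hr.le_union S T
  rwa [Finset.union_eq_right.2 h] at this

theorem le_card (hr : IsMatroidRank r) (S : Finset O) : r S ≤ S.card := by
  induction S using Finset.induction_on with
  | empty => simp [hr.empty]
  | insert o S ho ih =>
    rw [Finset.card_insert_of_notMem ho]
    rcases hr.step S o ho with h | h <;> omega

theorem union_eq (hr : IsMatroidRank r) (S T : Finset O)
    (h : ∀ o ∈ T, o ∉ S → r (insert o S) = r S) : r (S ∪ T) = r S := by
  induction T using Finset.induction_on with
  | empty => simp
  | insert o T ho ih =>
    have ih' := ih fun x hx => h x (Finset.mem_insert_of_mem hx)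
    rw [Finset.union_insert]
    by_cases hS : o ∈ S
    · rw [Finset.insert_eq_of_mem (Finset.mem_union_left _ hS), ih']
    · rw [← ih']
      refine hr.closure S _ Finset.subset_union_left o ?_ (h o (Finset.mem_insert_self _ _) hS)
      simp [hS, ho]

theorem exists_augment (hr : IsMatroidRank r) {S T : Finset O} (h : r S < r T) :
    ∃ o ∈ T, o ∉ S ∧ r (insert o S) = r S + 1 := by
  by_contra! hc
  have := hr.union_eq S T fun o ho hS => (hr.step S o hS).resolve_right (hc o ho hS)
  have h2 := hr.le_union T S
  rw [Finset.union_comm] at h2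
  omega

theorem exists_basis (hr : IsMatroidRank r) (S : Finset O) :
    ∃ B ⊆ S, r B = B.card ∧ B.card = r S := by
  induction S using Finset.induction_on with
  | empty => exact ⟨∅, by simp [hr.empty]⟩
  | insert o S ho ih =>
    obtain ⟨B, hB, h1, h2⟩ := ih
    rcases hr.step S o ho with h | h
    · exact ⟨B, hB.trans (Finset.subset_insert _ _), h1, by omega⟩
    · have hoB : o ∉ B := fun h => ho (hB h)
      refine ⟨insert o B, Finset.insert_subset_insert _ hB, ?_, ?_⟩
      · rw [Finset.card_insert_of_notMem hoB]
        rcases hr.step B o hoB with h' | h'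
        · have := hr.closure B S hB o ho h'
          omega
        · omega
      · rw [Finset.card_insert_of_notMem hoB]
        omega

theorem indep_subset (hr : IsMatroidRank r) {S T : Finset O} (hT : r T = T.card) (h : S ⊆ T) :
    r S = S.card := by
  have key : ∀ U : Finset O, r (S ∪ U) ≤ r S + U.card := by
    intro U
    induction U using Finset.induction_on with
    | empty => simp
    | insert o U ho ih =>
      rw [Finset.card_insert_of_notMem ho, Finset.union_insert]
      by_cases hm : o ∈ S ∪ U
      · rw [Finset.insert_eq_of_mem hm]; omega
      · rcases hr.step _ o hm with h | h <;> omega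
  have h1 := key (T \ S)
  rw [Finset.union_sdiff_of_subset h, hT] at h1
  have h2 := Finset.card_sdiff_add_card_eq_card h
  have h3 := hr.le_card S
  omega

end IsMatroidRank

end MatroidRank

/-! ### Independent partial allocations and transfers between them. -/

section PartialAllocations

variable {O ι : Type*} [Fintype O] [DecidableEq ι]

/-- The items that the partial allocation `f` gives to `i`. -/
def part (f : O → Option ι) (i : ι) : Finset O :=
  Finset.univ.filter fun o => f o = some i

@[simp]
theorem mem_part {f : O → Option ι} {i : ι} {o : O} : o ∈ part f i ↔ f o = some i := by
  simp [part]

/-- Every part of the partial allocation is independent. -/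
def PartsIndep (r : ι → Finset O → ℕ) (f : O → Option ι) : Prop :=
  ∀ i, r i (part f i) = (part f i).card

/-- The number of items that two partial allocations treat alike. -/
def agreement (f g : O → Option ι) : ℕ :=
  (Finset.univ.filter fun o => f o = g o).card

theorem agreement_le (f g : O → Option ι) : agreement f g ≤ Fintype.card O :=
  Finset.card_le_univ _

theorem exists_part_eq (B : ι → Finset O) (hB : ∀ i j, i ≠ j → Disjoint (B i) (B j)) :
    ∃ f : O → Option ι, ∀ i, part f i = B i := by
  classical
  refine ⟨fun o => if h : ∃ i, o ∈ B i then some h.choose else none, fun i => ?_⟩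
  ext o
  by_cases h : ∃ i, o ∈ B i
  · simp only [mem_part, dif_pos h, Option.some.injEq]
    constructor
    · intro e
      exact e ▸ h.choose_spec
    · intro hi
      by_contra hne
      exact Finset.disjoint_left.1 (hB _ _ hne) h.choose_spec hi
  · simp only [mem_part, dif_neg h]
    simp only [not_exists] at h
    simp [h i]

theorem part_disjoint (f : O → Option ι) (i j : ι) (h : i ≠ j) :
    Disjoint (part f i) (part f j) := by
  rw [Finset.disjoint_left]
  intro o h1 h2
  rw [mem_part] at h1 h2
  exact h (Option.some.inj (h1.symm.trans h2))

variable [DecidableEq O]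

theorem agreement_lt_update {f g : O → Option ι} {o : O} {x : Option ι} (h : f o ≠ x)
    (hg : g o = x) : agreement f g < agreement (Function.update f o x) g := by
  apply Finset.card_lt_card
  rw [Finset.ssubset_iff_of_subset]
  · exact ⟨o, by simp [hg], by simp [hg, h]⟩
  · intro p hp
    have hp' : f p = g p := by simpa using hp
    have : p ≠ o := by
      rintro rfl
      exact h (hp'.trans hg)
    simpa [Function.update_of_ne this] using hp'

theorem part_update_self (f : O → Option ι) (o : O) (i : ι) :
    part (Function.update f o (some i)) i = insert o (part f i) := by
  ext p
  by_cases h : p = o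
  · subst h; simp
  · simp [h]

theorem part_update_of_ne (f : O → Option ι) (o : O) {i j : ι} (hij : j ≠ i) :
    part (Function.update f o (some i)) j = (part f j).erase o := by
  ext p
  by_cases h : p = o
  · subst h; simp [hij.symm]
  · simp [h]

theorem PartsIndep.update {r : ι → Finset O → ℕ} (hr : ∀ i, IsMatroidRank (r i))
    {f : O → Option ι} (hf : PartsIndep r f) {o : O} {i : ι} (ho : o ∉ part f i)
    (h : r i (insert o (part f i)) = r i (part f i) + 1) :
    PartsIndep r (Function.update f o (some i)) := by
  intro j
  by_cases hj : j = i
  · subst hj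
    rw [part_update_self, h, Finset.card_insert_of_notMem ho, hf]
  · rw [part_update_of_ne _ _ hj]
    exact (hr j).indep_subset (hf j) (Finset.erase_subset _ _)

/-- Augment part `i` of `f` by an item of part `i` of `g`. If this robs an agent not above its size
in `g`, that agent is now short and is augmented in turn. Each move increases the agreement with
`g`, so the chain stops, at a free item or at an agent with a surplus over `g`. -/
theorem exists_transfer {r : ι → Finset O → ℕ} (hr : ∀ i, IsMatroidRank (r i))
    {g : O → Option ι} (hg : PartsIndep r g) {f : O → Option ι} (hf : PartsIndep r f) {i : ι}
    (hi : (part f i).card < (part g i).card) :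
    ∃ f', PartsIndep r f' ∧ agreement f g < agreement f' g ∧
      ((∀ j, (part f' j).card = (part f j).card + if j = i then 1 else 0) ∨
        ∃ k, k ≠ i ∧ (part g k).card < (part f k).card ∧
          ∀ j, (part f' j).card + (if j = k then 1 else 0) =
            (part f j).card + if j = i then 1 else 0) := by
  induction hm : Fintype.card O - agreement f g using Nat.strong_induction_on
    generalizing f i with
  | _ m ih =>
  subst hm
  obtain ⟨o, hoT, hoS, ho⟩ := (hr i).exists_augment (S := part f i) (T := part g i)
    (by rw [hf, hg]; exact hi)
  have hf1 := hf.update hr hoS ho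
  have hag : agreement f g < agreement (Function.update f o (some i)) g :=
    agreement_lt_update (by simpa using hoS) (by simpa using hoT)
  have hle := agreement_le (Function.update f o (some i)) g
  have hcard_i : (part (Function.update f o (some i)) i).card = (part f i).card + 1 := by
    rw [part_update_self, Finset.card_insert_of_notMem hoS]
  cases hfo : f o with
  | none =>
    refine ⟨_, hf1, hag, Or.inl fun j => ?_⟩
    by_cases hj : j = i
    · subst hj; simpa using hcard_i
    · rw [part_update_of_ne _ _ hj, Finset.erase_eq_of_notMem (by simp [hfo])]
      simp [hj]
  | some k =>
    have hki : k ≠ i := by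
      rintro rfl
      exact hoS (by simpa using hfo)
    have hcard : ∀ j, (part (Function.update f o (some i)) j).card + (if j = k then 1 else 0) =
        (part f j).card + if j = i then 1 else 0 := by
      intro j
      by_cases hj : j = i
      · subst hj; simpa [hki.symm] using hcard_i
      · rw [part_update_of_ne _ _ hj]
        by_cases hjk : j = k
        · subst hjk
          have := Finset.card_erase_add_one (s := part f j) (a := o) (by simpa using hfo)
          simpa [hj] using this
        · rw [Finset.erase_eq_of_notMem]
          · simp [hj, hjk]
          · simp only [mem_part, hfo, Option.some.injEq]
            exact fun h => hjk h.symm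
    by_cases hk : (part g k).card < (part f k).card
    · exact ⟨_, hf1, hag, Or.inr ⟨k, hki, hk, hcard⟩⟩
    have hck := hcard k
    simp only [if_true, hki, if_false] at hck
    obtain ⟨f', h1, h2, h3⟩ := ih _ (by omega) hf1 (i := k) (by omega) rfl
    refine ⟨f', h1, hag.trans h2, ?_⟩
    rcases h3 with h3 | ⟨l, hlk, hl, h3⟩
    · left
      intro j
      rw [h3 j, hcard j]
    · right
      have hli : l ≠ i := by
        rintro rfl
        omega
      have hcl := hcard l
      simp only [hlk, hli, if_false] at hcl
      refine ⟨l, hli, by omega, fun j => ?_⟩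
      have e1 := h3 j
      have e2 := hcard j
      omega

theorem exists_truncate {r : ι → Finset O → ℕ} (hr : ∀ i, IsMatroidRank (r i))
    {f : O → Option ι} (hf : PartsIndep r f) (t : ℕ) :
    ∃ f', PartsIndep r f' ∧ ∀ i, (part f' i).card = min (part f i).card t := by
  have h : ∀ i, ∃ B ⊆ part f i, B.card = min (part f i).card t := fun i =>
    Finset.exists_subset_card_eq (min_le_left _ _)
  choose B hB hc using h
  obtain ⟨f', hf'⟩ := exists_part_eq B fun i j hij =>
    (part_disjoint f i j hij).mono (hB i) (hB j)
  refine ⟨f', fun i => ?_, fun i => by rw [hf', hc]⟩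
  rw [hf']
  exact (hr i).indep_subset (hf i) (hB i)

end PartialAllocations

/-! ### Optimal truncated sums for one family of matroids. -/

section Lorenz

variable {O ι : Type*} [Fintype O] [DecidableEq O] [DecidableEq ι] [Fintype ι]

/-- Some independent partial allocation maximizes every truncated sum of the part sizes. -/
theorem exists_lorenz_partial {r : ι → Finset O → ℕ} (hr : ∀ i, IsMatroidRank (r i)) :
    ∃ f : O → Option ι, PartsIndep r f ∧ ∀ g, PartsIndep r g → ∀ t : ℕ,
      ∑ i, min (part g i).card t ≤ ∑ i, min (part f i).card t := by
  classical
  let K : ℤ := Fintype.card O + 1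
  -- The summand `x (2K - x)` is strictly increasing for `x ≤ |O|` and strictly concave, so `Φ`
  -- rewards both growth and balance.
  let Φ : (O → Option ι) → ℤ := fun f => ∑ i, ((part f i).card : ℤ) * (2 * K - (part f i).card)
  have hne : (Finset.univ.filter fun f : O → Option ι => PartsIndep r f).Nonempty := by
    refine ⟨fun _ => none, ?_⟩
    simp only [Finset.mem_filter, Finset.mem_univ, true_and]
    intro i
    have : part (fun _ : O => (none : Option ι)) i = ∅ := by ext; simp
    rw [this, (hr i).empty, Finset.card_empty]
  obtain ⟨f, hf, hmax⟩ := Finset.exists_max_image _ Φ hne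
  simp only [Finset.mem_filter, Finset.mem_univ, true_and] at hf hmax
  refine ⟨f, hf, ?_⟩
  by_contra! hcon
  obtain ⟨g0, hg0, t, ht⟩ := hcon
  obtain ⟨g1, hg1, hg1c⟩ := exists_truncate hr hg0 t
  have hne2 : (Finset.univ.filter fun g : O → Option ι => PartsIndep r g ∧
      (∀ i, (part g i).card ≤ t) ∧
      ∑ i, min (part f i).card t < ∑ i, (part g i).card).Nonempty := by
    refine ⟨g1, ?_⟩
    simp only [Finset.mem_filter, Finset.mem_univ, true_and]
    refine ⟨hg1, fun i => by rw [hg1c]; exact min_le_right _ _, ?_⟩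
    simpa only [hg1c] using ht
  -- Among counterexamples with parts of size at most `t`, take one closest to `f`. A part smaller
  -- than `min |f_i| t` could be enlarged by a transfer towards `f`, contradicting closeness.
  obtain ⟨g, hg, hgmax⟩ := Finset.exists_max_image _ (fun g => agreement g f) hne2
  simp only [Finset.mem_filter, Finset.mem_univ, true_and] at hg hgmax
  obtain ⟨hgI, hgt, hgs⟩ := hg
  have hge : ∀ i, min (part f i).card t ≤ (part g i).card := by
    intro i
    by_contra! hi
    rw [lt_min_iff] at hi
    obtain ⟨g', h1, h2, h3⟩ := exists_transfer hr hf hgI hi.1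
    refine absurd (hgmax g' ⟨h1, ?_, ?_⟩) (not_le.2 h2)
    · intro j
      have hj := hgt j
      have : (part g' j).card ≤ (part g j).card + if j = i then 1 else 0 := by
        rcases h3 with h3 | ⟨k, _, _, h3⟩
        · exact (h3 j).le
        · have := h3 j
          omega
      split_ifs at this with hji
      · subst hji; omega
      · omega
    · refine hgs.trans_le ?_
      rcases h3 with h3 | ⟨k, _, _, h3⟩
      · exact Finset.sum_le_sum fun j _ => by have := h3 j; omega
      · have := Finset.sum_congr rfl fun j (_ : j ∈ Finset.univ) => h3 j
        simp only [Finset.sum_add_distrib, Finset.sum_ite_eq', Finset.mem_univ, if_true] at this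
        omega
  obtain ⟨i, -, hi⟩ := Finset.exists_lt_of_sum_lt hgs
  have hti := hgt i
  have hfi : (part f i).card < t := by
    by_contra! h
    rw [min_eq_right h] at hi
    omega
  rw [min_eq_left hfi.le] at hi
  obtain ⟨f', h1, -, h3⟩ := exists_transfer hr hgI hf hi
  refine absurd (hmax f' h1) (not_le.2 ?_)
  rw [← sub_pos]
  simp only [Φ, ← Finset.sum_sub_distrib]
  have hcO : ((part f i).card : ℤ) ≤ Fintype.card O := by exact_mod_cast Finset.card_le_univ _
  rcases h3 with h3 | ⟨k, hki, hk, h3⟩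
  · rw [Finset.sum_eq_single i]
    · rw [h3 i, if_pos rfl]
      push_cast
      simp only [K]
      nlinarith
    · intro j _ hj
      rw [h3 j, if_neg hj, add_zero, sub_self]
    · simp
  -- The donor satisfies `min |f_k| t ≤ |g_k| < |f_k|`, so `|f_i| < t < |f_k|`: the sizes differ by
  -- at least 2 and the transfer raises `Φ`.
  · have htk := hge k
    have hkt : t < (part f k).card := by
      by_contra! h
      rw [min_eq_left h] at htk
      omega
    have hki' := h3 i
    have hkk := h3 k
    simp only [if_true, hki, hki.symm, if_false, add_zero] at hki' hkk
    rw [Finset.sum_eq_add i k hki.symm]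
    · rw [hki', ← hkk]
      rw [← hkk] at hkt
      have : ((part f i).card : ℤ) + 1 ≤ (part f' k).card := by
        have : (part f i).card + 1 ≤ (part f' k).card := by omega
        exact_mod_cast this
      push_cast
      nlinarith
    · rintro j - ⟨hj1, hj2⟩
      have := h3 j
      simp only [hj1, hj2, if_false, add_zero] at this
      rw [this, sub_self]
    · simp
    · simp

end Lorenz

/-! ### Maximum extensions and balanced decrements. -/

section Extension

variable {O ι : Type*} [Fintype O] [DecidableEq O] [DecidableEq ι] [Fintype ι]

theorem sum_card_part (f : O → Option ι) :
    ∑ i, (part f i).card = (Finset.univ.filter fun o => f o ≠ none).card := by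
  rw [← Finset.card_biUnion fun i _ j _ h => part_disjoint f i j h]
  congr 1
  ext o
  simp [Option.ne_none_iff_exists']

theorem sum_card_part_add (f : O → Option ι) :
    ∑ i, (part f i).card + (Finset.univ.filter fun o => f o = none).card = Fintype.card O := by
  rw [sum_card_part, add_comm]
  exact Finset.card_filter_add_card_filter_not _

theorem sum_card_part_le_update (f : O → Option ι) (o : O) (i : ι) :
    ∑ j, (part f j).card ≤ ∑ j, (part (Function.update f o (some i)) j).card := by
  rw [sum_card_part, sum_card_part]
  refine Finset.card_le_card fun p hp => ?_
  by_cases h : p = o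
  · subst h; simp
  · simpa [h] using hp

/-- If `r i` is a quotient of `g i`, then an `r`-independent partial allocation can be replaced by
a largest `g`-independent one without decreasing the `r`-ranks. -/
theorem exists_maximum_extension {r g : ι → Finset O → ℕ} (hr : ∀ i, IsMatroidRank (r i))
    (hg : ∀ i, IsMatroidRank (g i))
    (hrg : ∀ i S o, o ∉ S → r i (insert o S) = r i S + 1 → g i (insert o S) = g i S + 1)
    {f : O → Option ι} (hf : PartsIndep r f) :
    ∃ G : O → Option ι, PartsIndep g G ∧ (∀ i, (part f i).card ≤ r i (part G i)) ∧
      ∀ G', PartsIndep g G' → ∑ i, (part G' i).card ≤ ∑ i, (part G i).card := by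
  classical
  -- Agreement is at most `|O|`, so this weight compares total size first and agreement with `f`
  -- second.
  let Φ : (O → Option ι) → ℕ := fun G =>
    (Fintype.card O + 1) * ∑ i, (part G i).card + agreement G f
  have hne : (Finset.univ.filter fun G : O → Option ι => PartsIndep g G).Nonempty := by
    refine ⟨fun _ => none, ?_⟩
    simp only [Finset.mem_filter, Finset.mem_univ, true_and]
    intro i
    have : part (fun _ : O => (none : Option ι)) i = ∅ := by ext; simp
    rw [this, (hg i).empty, Finset.card_empty]
  obtain ⟨G, hG, hmax⟩ := Finset.exists_max_image _ Φ hne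
  simp only [Finset.mem_filter, Finset.mem_univ, true_and] at hG hmax
  refine ⟨G, hG, fun i => ?_, fun G' hG' => ?_⟩
  · by_contra! hi
    rw [← hf i] at hi
    -- An `r`-augmenting item is also `g`-augmenting; reassigning it to `i` keeps the total from
    -- dropping and increases the agreement.
    obtain ⟨o, ho, hoG, h⟩ := (hr i).exists_augment hi
    have h1 := hmax _ (hG.update hg hoG (hrg i _ o hoG h))
    have h2 : agreement G f < agreement (Function.update G o (some i)) f :=
      agreement_lt_update (by simpa using hoG) (by simpa using ho)
    have h3 := Nat.mul_le_mul_left (Fintype.card O + 1) (sum_card_part_le_update G o i)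
    simp only [Φ] at h1
    omega
  · by_contra! h
    have h1 := hmax _ hG'
    have h2 := agreement_le G f
    have h3 := Nat.mul_le_mul_left (Fintype.card O + 1) h
    simp only [Φ] at h1
    rw [Nat.succ_eq_add_one, mul_add, mul_one] at h3
    omega

/-- The unit decrements indexed by `P` can be distributed over the coordinates of `a` so that
each level `t` either does not notice them or bounds all resulting coordinates. -/
theorem exists_balanced_decrement [Nonempty ι] (a : ι → ℤ) (P : Finset O) :
    ∃ h : O → ι, ∀ t : ℤ,
      (∀ i, min (a i - (P.filter fun o => h o = i).card) t = min (a i) t) ∨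
        ∀ i, a i - (P.filter fun o => h o = i).card ≤ t := by
  obtain ⟨h, -, hmin⟩ := Finset.exists_min_image (Finset.univ : Finset (O → ι))
    (fun h => ∑ i, (a i - (P.filter fun o => h o = i).card) ^ 2) Finset.univ_nonempty
  -- Otherwise moving one decrement from `i` to `j` would lower the sum of squares.
  have key : ∀ i j, (P.filter fun o => h o = i).Nonempty →
      a j - (P.filter fun o => h o = j).card ≤ a i - (P.filter fun o => h o = i).card + 1 := by
    rintro i j ⟨o, ho⟩
    rw [Finset.mem_filter] at ho
    by_cases hij : j = i
    · subst hij; omega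
    have hm := hmin (Function.update h o j) (Finset.mem_univ _)
    rw [← sub_nonneg, ← Finset.sum_sub_distrib, Finset.sum_eq_add i j (Ne.symm hij)] at hm
    · have e1 : (P.filter fun p => Function.update h o j p = i) =
          (P.filter fun p => h p = i).erase o := by
        ext p
        by_cases hp : p = o
        · subst hp; simp [hij]
        · simp [hp]
      have e2 : (P.filter fun p => Function.update h o j p = j) =
          insert o (P.filter fun p => h p = j) := by
        ext p
        by_cases hp : p = o
        · subst hp; simp [ho.1]
        · simp [hp]
      have c1 : (((P.filter fun p => h p = i).erase o).card : ℤ) =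
          (P.filter fun p => h p = i).card - 1 := by
        have := Finset.card_erase_add_one (s := P.filter fun p => h p = i) (a := o)
          (by simp [ho.1, ho.2])
        omega
      have c2 : ((insert o (P.filter fun p => h p = j)).card : ℤ) =
          (P.filter fun p => h p = j).card + 1 := by
        rw [Finset.card_insert_of_notMem]
        · push_cast; ring
        · simp [ho.2, Ne.symm hij]
      rw [e1, e2, c1, c2] at hm
      linarith
    · rintro k - ⟨hk1, hk2⟩
      have : (P.filter fun p => Function.update h o j p = k) = P.filter fun p => h p = k := by
        ext p
        by_cases hp : p = o
        · subst hp; simp [ho.2, Ne.symm hk1, Ne.symm hk2]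
        · simp [hp]
      rw [this, sub_self]
    · simp
    · simp
  refine ⟨h, fun t => ?_⟩
  -- If a decremented coordinate ends below `t`, integrality and `key` bound all coordinates by `t`;
  -- if none does, truncation at `t` hides every decrement.
  by_cases hc : ∃ i, (P.filter fun o => h o = i).Nonempty ∧
      a i - (P.filter fun o => h o = i).card < t
  · obtain ⟨i, hi, hit⟩ := hc
    right
    intro j
    have := key i j hi
    omega
  · left
    intro i
    by_cases hi : (P.filter fun o => h o = i).Nonempty
    · have : ¬ a i - (P.filter fun o => h o = i).card < t := fun h => hc ⟨i, hi, h⟩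
      rw [min_eq_right (by omega), min_eq_right (by omega)]
    · rw [Finset.not_nonempty_iff_eq_empty.1 hi]
      simp

end Extension

/-! ### Truncated sums of multiples of `c`. -/

/-- For integer `x`, truncating `c x` is affine in the threshold between consecutive multiples of
`c`. -/
theorem min_mul_eq_interpolate (c q s x : ℕ) (hs : s < c) :
    min ((c : ℤ) * x) (c * q + s) =
      (c - s : ℤ) * ((min x q : ℕ) : ℤ) + s * ((min x (q + 1) : ℕ) : ℤ) := by
  rcases le_or_gt x q with h | h
  · have : (c : ℤ) * x ≤ c * q := by exact_mod_cast Nat.mul_le_mul_left c h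
    rw [min_eq_left h, min_eq_left (by omega : x ≤ q + 1), min_eq_left (by omega)]
    ring
  · have : (c : ℤ) * (q + 1) ≤ c * x := by exact_mod_cast Nat.mul_le_mul_left c h
    have hs' : (s : ℤ) < c := by exact_mod_cast hs
    rw [min_eq_right h.le, min_eq_right (by omega : q + 1 ≤ x), min_eq_right (by linarith)]
    push_cast
    ring

theorem sum_min_mul_le {ι : Type*} [Fintype ι] {a b : ι → ℕ} {c : ℕ} (hc : 0 < c)
    (h : ∀ t : ℕ, ∑ i, min (b i) t ≤ ∑ i, min (a i) t) (t : ℤ) :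
    ∑ i, min ((c : ℤ) * b i) t ≤ ∑ i, min ((c : ℤ) * a i) t := by
  rcases le_or_gt 0 t with ht | ht
  · lift t to ℕ using ht
    have hs := Nat.mod_lt t hc
    have e : (t : ℤ) = c * (t / c : ℕ) + (t % c : ℕ) := by exact_mod_cast (Nat.div_add_mod t c).symm
    rw [e]
    simp only [min_mul_eq_interpolate c _ _ _ hs, Finset.sum_add_distrib, ← Finset.mul_sum,
      ← Nat.cast_sum]
    have h1 : (0 : ℤ) ≤ c - (t % c : ℕ) := by
      have : ((t % c : ℕ) : ℤ) < c := by exact_mod_cast hs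
      linarith
    exact add_le_add (mul_le_mul_of_nonneg_left (by exact_mod_cast h _) h1)
      (mul_le_mul_of_nonneg_left (by exact_mod_cast h _) (by positivity))
  · refine Finset.sum_le_sum fun i _ => ?_
    rw [min_eq_right (ht.le.trans (by positivity)), min_eq_right (ht.le.trans (by positivity))]

/-! ### From truncated sums to sums of smallest entries. -/

section Sorting

variable {n : ℕ}

theorem sortAsc_monotone (x : Fin n → ℝ) : Monotone (sortAsc x) := Tuple.monotone_sort x

theorem sum_comp_sortAsc {M : Type*} [AddCommMonoid M] (φ : ℝ → M) (x : Fin n → ℝ) :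
    ∑ i, φ (sortAsc x i) = ∑ i, φ (x i) :=
  Equiv.sum_comp (Tuple.sort x) fun i => φ (x i)

/-- Truncate at the entry of sorted `y` at index `k`: for `y` this gives exactly the prefix sum plus
that threshold for each later index, for `x` at most the analogous quantity. -/
theorem sum_Iic_sortAsc_le {x y : Fin n → ℝ}
    (h : ∀ j, ∑ i, min (y i) (y j) ≤ ∑ i, min (x i) (y j)) (k : Fin n) :
    ∑ j ∈ Finset.Iic k, sortAsc y j ≤ ∑ j ∈ Finset.Iic k, sortAsc x j := by
  obtain ⟨t, ht⟩ : ∃ t, t = sortAsc y k := ⟨_, rfl⟩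
  have h1 : ∑ i, min (sortAsc y i) t ≤ ∑ i, min (sortAsc x i) t := by
    rw [sum_comp_sortAsc (fun z => min z t), sum_comp_sortAsc (fun z => min z t), ht]
    exact h _
  rw [← Finset.sum_add_sum_compl (Finset.Iic k), ← Finset.sum_add_sum_compl (Finset.Iic k)
    fun i => min (sortAsc x i) t] at h1
  have h2 : ∑ i ∈ Finset.Iic k, min (sortAsc y i) t = ∑ i ∈ Finset.Iic k, sortAsc y i :=
    Finset.sum_congr rfl fun i hi =>
      min_eq_left (ht ▸ sortAsc_monotone y (Finset.mem_Iic.1 hi))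
  have h3 : ∑ i ∈ (Finset.Iic k)ᶜ, min (sortAsc y i) t = ∑ i ∈ (Finset.Iic k)ᶜ, t := by
    refine Finset.sum_congr rfl fun i hi => min_eq_right (ht ▸ sortAsc_monotone y ?_)
    rw [Finset.mem_compl, Finset.mem_Iic, not_le] at hi
    exact hi.le
  have h4 : ∑ i ∈ Finset.Iic k, min (sortAsc x i) t ≤ ∑ i ∈ Finset.Iic k, sortAsc x i :=
    Finset.sum_le_sum fun i _ => min_le_left _ _
  have h5 : ∑ i ∈ (Finset.Iic k)ᶜ, min (sortAsc x i) t ≤ ∑ i ∈ (Finset.Iic k)ᶜ, t :=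
    Finset.sum_le_sum fun i _ => min_le_right _ _
  linarith

theorem eq_of_sum_Iic_le_of_not_lexDominates {x z : Fin n → ℝ}
    (h : ∀ k, ∑ j ∈ Finset.Iic k, x j ≤ ∑ j ∈ Finset.Iic k, z j) (hl : ¬ LexDominates z x) :
    z = x := by
  funext k
  induction k using WellFoundedLT.induction with
  | _ k ih =>
  by_contra hne
  refine hl ⟨k, ih, lt_of_le_of_ne ?_ (Ne.symm hne)⟩
  have hk := h k
  rw [← Finset.Iio_insert, Finset.sum_insert (by simp), Finset.sum_insert (by simp),
    Finset.sum_congr rfl fun j hj => ih j (Finset.mem_Iio.1 hj)] at hk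
  linarith

end Sorting

/-! ### Rank decomposition of order-neutral valuations. -/

section OrderNeutral

variable {O : Type*} [DecidableEq O]

theorem sum_sortedTelescopingVector {M : Type*} [AddCommMonoid M] (φ : ℝ → M)
    (v : Finset O → ℝ) (S : Finset O) (π : Fin S.card ≃ S) :
    ∑ j, φ (sortedTelescopingVector v S π j) =
      ∑ j, φ (marginal v (itemsBefore π j) (π j : O)) :=
  sum_comp_sortAsc φ _

/-- The new ordering puts `o` last, leaving all earlier prefixes unchanged. -/
theorem exists_ordering_insert {S : Finset O} (π : Fin S.card ≃ S) {o : O} (ho : o ∉ S) :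
    ∃ (π' : Fin (insert o S).card ≃ (insert o S : Finset O)), ∀ φ : Finset O → O → ℕ,
      ∑ j, φ (itemsBefore π' j) (π' j : O) = ∑ j, φ (itemsBefore π j) (π j : O) + φ S o := by
  have hcard : (insert o S).card = S.card + 1 := Finset.card_insert_of_notMem ho
  let F : Fin (S.card + 1) → (insert o S : Finset O) :=
    Fin.lastCases ⟨o, Finset.mem_insert_self _ _⟩
      fun j => ⟨π j, Finset.mem_insert_of_mem (π j).2⟩
  have hFl : (F (Fin.last _) : O) = o := by simp [F]
  have hFc : ∀ j : Fin S.card, (F j.castSucc : O) = π j := by simp [F]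
  have hF : Function.Bijective F := by
    rw [Fintype.bijective_iff_injective_and_card]
    refine ⟨fun i j => ?_, by simp [hcard]⟩
    intro hij
    have hij' : (F i : O) = F j := congrArg _ hij
    induction i using Fin.lastCases with
    | last =>
      induction j using Fin.lastCases with
      | last => rfl
      | cast j =>
        rw [hFl, hFc] at hij'
        exact absurd (hij' ▸ (π j).2) ho
    | cast i =>
      induction j using Fin.lastCases with
      | last =>
        rw [hFl, hFc] at hij'
        exact absurd (hij' ▸ (π i).2) ho
      | cast j =>
        rw [hFc, hFc] at hij'
        rw [π.injective (Subtype.ext hij')]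
  refine ⟨(finCongr hcard).trans (Equiv.ofBijective F hF), fun φ => ?_⟩
  rw [← Equiv.sum_comp (finCongr hcard).symm, Fin.sum_univ_castSucc]
  have hb : ∀ j : Fin (S.card + 1),
      itemsBefore ((finCongr hcard).trans (Equiv.ofBijective F hF)) ((finCongr hcard).symm j) =
        (Finset.univ.filter fun l => l < j).image fun l => (F l : O) := by
    intro j
    ext p
    simp only [itemsBefore, Finset.mem_image, Finset.mem_filter, Finset.mem_univ, true_and]
    constructor
    · rintro ⟨l, hl, rfl⟩
      exact ⟨finCongr hcard l, hl, rfl⟩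
    · rintro ⟨l, hl, rfl⟩
      exact ⟨(finCongr hcard).symm l, hl, rfl⟩
  have hv : ∀ j : Fin (S.card + 1), (((finCongr hcard).trans (Equiv.ofBijective F hF))
      ((finCongr hcard).symm j) : O) = F j := fun j => rfl
  simp only [hb, hv, hFl, hFc]
  congr 1
  · refine Finset.sum_congr rfl fun j _ => ?_
    congr 1
    ext p
    simp only [itemsBefore, Finset.mem_image, Finset.mem_filter, Finset.mem_univ, true_and]
    constructor
    · rintro ⟨l, hl, rfl⟩
      induction l using Fin.lastCases with
      | last => exact absurd (hl.trans (Fin.castSucc_lt_last j)) (lt_irrefl _)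
      | cast l => exact ⟨l, Fin.castSucc_lt_castSucc_iff.1 hl, (hFc l).symm⟩
    · rintro ⟨l, hl, rfl⟩
      exact ⟨l.castSucc, Fin.castSucc_lt_castSucc_iff.2 hl, hFc l⟩
  · congr 1
    ext p
    simp only [Finset.mem_image, Finset.mem_filter, Finset.mem_univ, true_and]
    constructor
    · rintro ⟨l, hl, rfl⟩
      induction l using Fin.lastCases with
      | last => exact absurd hl (lt_irrefl _)
      | cast l => rw [hFc]; exact (π l).2
    · intro hp
      refine ⟨(π.symm ⟨p, hp⟩).castSucc, Fin.castSucc_lt_last _, ?_⟩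
      rw [hFc]
      simp

/-- Order neutrality makes every count of marginal gains a function of the bundle. -/
theorem IsOrderNeutral.exists_count {v : Finset O → ℝ} (hv : IsOrderNeutral v) (φ : ℝ → ℕ) :
    ∃ F : Finset O → ℕ, F ∅ = 0 ∧
      ∀ S o, o ∉ S → F (insert o S) = F S + φ (marginal v S o) := by
  refine ⟨fun S => ∑ j, φ (sortedTelescopingVector v S S.equivFin.symm j), ?_, ?_⟩
  · exact Finset.sum_eq_zero fun j _ => absurd j.2 (by simp)
  · intro S o ho
    obtain ⟨π', h⟩ := exists_ordering_insert S.equivFin.symm ho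
    dsimp only
    rw [hv _ _ π', sum_sortedTelescopingVector, sum_sortedTelescopingVector]
    exact h fun T p => φ (marginal v T p)

/-- A `{-1, 0, c}`-ONSUB valuation is `c r + g - |S|` for matroid rank functions `r` and `g`, with
`r` a quotient of `g`. -/
theorem IsOnsub.exists_rank {v : Finset O → ℝ} {c : ℕ} (hc : 0 < c)
    (hv : IsOnsub ({-1, 0, (c : ℝ)} : Set ℝ) v) :
    ∃ r g : Finset O → ℕ, IsMatroidRank r ∧ IsMatroidRank g ∧
      (∀ S o, o ∉ S → r (insert o S) = r S + 1 → g (insert o S) = g S + 1) ∧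
      ∀ S, v S = c * r S + g S - S.card := by
  classical
  obtain ⟨⟨⟨h0, hsub⟩, hval⟩, hon⟩ := hv
  have hc' : (0 : ℝ) < c := by exact_mod_cast hc
  obtain ⟨r, hr0, hr⟩ := hon.exists_count fun x => if (c : ℝ) ≤ x then 1 else 0
  obtain ⟨g, hg0, hg⟩ := hon.exists_count fun x => if 0 ≤ x then 1 else 0
  -- By submodularity, a marginal below the threshold `a` stays below it on larger bundles, so
  -- counting marginals of at least `a` gives a matroid rank.
  have rank : ∀ (a : ℝ) (F : Finset O → ℕ), F ∅ = 0 →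
      (∀ S o, o ∉ S → F (insert o S) = F S + if a ≤ marginal v S o then 1 else 0) →
      IsMatroidRank F := by
    intro a F hF0 hF
    refine ⟨hF0, fun S o ho => ?_, fun S T hST o ho h => ?_⟩
    · rw [hF S o ho]
      split_ifs <;> simp
    · rw [hF S o fun h => ho (hST h)] at h
      rw [hF T o ho]
      have h2 : ¬ a ≤ marginal v S o := by
        intro hle
        simp [hle] at h
      have h3 := hsub S T hST o ho
      rw [if_neg fun hle => h2 (hle.trans h3), add_zero]
  refine ⟨r, g, rank _ r hr0 hr, rank _ g hg0 hg, fun S o ho h => ?_, fun S => ?_⟩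
  · rw [hr S o ho] at h
    have h2 : (c : ℝ) ≤ marginal v S o := by
      by_contra hle
      simp [hle] at h
    rw [hg S o ho, if_pos (hc'.le.trans h2)]
  · induction S using Finset.induction_on with
    | empty => simp [h0, hr0, hg0]
    | insert o S ho ih =>
      have e : v (insert o S) = v S + marginal v S o := by simp [marginal]
      rw [e, ih, hr S o ho, hg S o ho, Finset.card_insert_of_notMem ho]
      have hm := hval S o ho
      simp only [Set.mem_insert_iff, Set.mem_singleton_iff] at hm
      rcases hm with hm | hm | hm
      · rw [hm, if_neg (by linarith), if_neg (by norm_num)]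
        push_cast; ring
      · rw [hm, if_neg (by linarith), if_pos le_rfl]
        push_cast; ring
      · rw [hm, if_pos le_rfl, if_pos hc'.le]
        push_cast; ring

end OrderNeutral

/-! ### The truncation-dominating allocation and the theorem. -/

section Main

variable {n : ℕ} {O : Type*} [Fintype O] [DecidableEq O]

theorem Allocation.IsComplete.sum_card_bundle {Y : Allocation n O} (hY : Y.IsComplete) :
    ∑ i, (Y.bundle i).card = Fintype.card O := by
  rw [← Finset.card_biUnion fun i _ j _ h => Y.disjoint i j h, ← Finset.card_univ]
  congr 1
  ext o
  simpa using hY o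

/-- Every allocation contains an independent partial allocation of the same ranks. -/
theorem Allocation.exists_basis {r : Fin n → Finset O → ℕ} (hr : ∀ i, IsMatroidRank (r i))
    (Y : Allocation n O) :
    ∃ f : O → Option (Fin n), PartsIndep r f ∧ ∀ i, (part f i).card = r i (Y.bundle i) := by
  choose B hB h1 h2 using fun i => (hr i).exists_basis (Y.bundle i)
  obtain ⟨f, hf⟩ := exists_part_eq B fun i j hij => (Y.disjoint i j hij).mono (hB i) (hB j)
  exact ⟨f, fun i => by rw [hf, h1], fun i => by rw [hf, h2]⟩

theorem exists_truncation_dominating [NeZero n] {c : ℕ} (hc : 0 < c)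
    {v : Fin n → Finset O → ℝ} {r g : Fin n → Finset O → ℕ} (hr : ∀ i, IsMatroidRank (r i))
    (hg : ∀ i, IsMatroidRank (g i))
    (hrg : ∀ i S o, o ∉ S → r i (insert o S) = r i S + 1 → g i (insert o S) = g i S + 1)
    (hv : ∀ i S, v i S = c * r i S + g i S - S.card) :
    ∃ Z : Allocation n O, Z.IsComplete ∧ ∀ Y : Allocation n O, Y.IsComplete → ∀ t : ℤ,
      ∑ i, min (Y.utility v i) t ≤ ∑ i, min (Z.utility v i) t := by
  obtain ⟨f, hf, hfmax⟩ := exists_lorenz_partial hr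
  obtain ⟨G, hG, hGr, hGmax⟩ := exists_maximum_extension hr hg hrg hf
  obtain ⟨h, hh⟩ := exists_balanced_decrement (fun i => (c : ℤ) * (part f i).card)
    (Finset.univ.filter fun o => G o = none)
  let P : Finset O := Finset.univ.filter fun o => G o = none
  let d : Fin n → ℤ := fun i => ((P.filter fun o => h o = i).card : ℤ)
  let z : Fin n → ℤ := fun i => (c : ℤ) * (part f i).card - d i
  have hd : ∑ i, d i = P.card := by
    simp only [d]
    rw [Finset.card_eq_sum_card_fiberwise (f := h) (t := Finset.univ) (by simp)]
    push_cast
    rfl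
  let Z : Allocation n O :=
    ⟨fun i => part G i ∪ P.filter fun o => h o = i, by
      intro i j hij
      rw [Finset.disjoint_left]
      intro o h1 h2
      simp only [P, Finset.mem_union, mem_part, Finset.mem_filter, Finset.mem_univ,
        true_and] at h1 h2
      rcases h1 with h1 | h1 <;> rcases h2 with h2 | h2
      · exact hij (Option.some.inj (h1.symm.trans h2))
      · simp [h1] at h2
      · simp [h2] at h1
      · exact hij (h1.2.symm.trans h2.2)⟩
  have hZ : Z.IsComplete := by
    intro o
    cases ho : G o with
    | none => exact ⟨h o, by simp [Z, P, ho]⟩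
    | some i => exact ⟨i, by simp [Z, ho]⟩
  have hzZ : ∀ i, (z i : ℝ) ≤ Z.utility v i := by
    intro i
    have h1 : (part f i).card ≤ r i (Z.bundle i) :=
      (hGr i).trans ((hr i).mono Finset.subset_union_left)
    have h2 : (part G i).card ≤ g i (Z.bundle i) := by
      rw [← hG i]
      exact (hg i).mono Finset.subset_union_left
    have h3 : (Z.bundle i).card ≤ (part G i).card + (P.filter fun o => h o = i).card :=
      Finset.card_union_le _ _
    have h1' : (c : ℝ) * (part f i).card ≤ c * r i (Z.bundle i) :=
      mul_le_mul_of_nonneg_left (by exact_mod_cast h1) (by positivity)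
    have h2' : ((part G i).card : ℝ) ≤ g i (Z.bundle i) := by exact_mod_cast h2
    have h3' : ((Z.bundle i).card : ℝ) ≤
        (part G i).card + (P.filter fun o => h o = i).card := by exact_mod_cast h3
    simp only [Allocation.utility, hv, z, d]
    push_cast
    linarith
  refine ⟨Z, hZ, fun Y hY t => ?_⟩
  let y : Fin n → ℤ := fun i =>
    (c : ℤ) * r i (Y.bundle i) + g i (Y.bundle i) - (Y.bundle i).card
  have hy : ∀ i, Y.utility v i = (y i : ℝ) := by
    intro i
    simp only [Allocation.utility, hv, y]
    push_cast
    rfl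
  suffices hyz : ∑ i, min (y i) t ≤ ∑ i, min (z i) t by
    calc ∑ i, min (Y.utility v i) (t : ℝ) = ((∑ i, min (y i) t : ℤ) : ℝ) := by
          push_cast
          simp only [hy]
      _ ≤ ((∑ i, min (z i) t : ℤ) : ℝ) := by exact_mod_cast hyz
      _ ≤ _ := by
          push_cast
          exact Finset.sum_le_sum fun i _ => min_le_min_right _ (hzZ i)
  obtain ⟨b, hb, hbc⟩ := Y.exists_basis hr
  have hcb := sum_min_mul_le hc (hfmax b hb)
  simp only [hbc] at hcb
  -- Charges invisible at `t`: drop `g - |S| ≤ 0` and use optimality of `f`. All values at most `t`: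
  -- compare totals, where `f` maximizes the `r` part and `G` the `g` part.
  rcases hh t with ht | ht
  · calc ∑ i, min (y i) t ≤ ∑ i, min ((c : ℤ) * r i (Y.bundle i)) t := by
          refine Finset.sum_le_sum fun i _ => min_le_min_right _ ?_
          have : (g i (Y.bundle i) : ℤ) ≤ (Y.bundle i).card := by
            exact_mod_cast (hg i).le_card _
          simp only [y]
          linarith
      _ ≤ ∑ i, min ((c : ℤ) * (part f i).card) t := hcb t
      _ = ∑ i, min (z i) t := (Finset.sum_congr rfl fun i _ => ht i).symm
  · obtain ⟨b', hb', hbc'⟩ := Y.exists_basis hg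
    have hgs := hGmax b' hb'
    simp only [hbc'] at hgs
    have hPs : ∑ i, (part G i).card + P.card = Fintype.card O := sum_card_part_add G
    have hYs := hY.sum_card_bundle
    have hrs : ∑ i, r i (Y.bundle i) ≤ ∑ i, (part f i).card := by
      -- At threshold `|O|` truncation is vacuous, so `f` also has maximum total size.
      have h1 := hfmax b hb (Fintype.card O)
      simp only [fun (f : O → Option (Fin n)) i =>
        min_eq_left (Finset.card_le_univ (part f i))] at h1
      simpa only [hbc] using h1
    have hrs' : (c : ℤ) * ∑ i, (r i (Y.bundle i) : ℤ) ≤ c * ∑ i, ((part f i).card : ℤ) :=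
      mul_le_mul_of_nonneg_left (by exact_mod_cast hrs) (by positivity)
    have hgs' : ∑ i, (g i (Y.bundle i) : ℤ) ≤ ∑ i, ((part G i).card : ℤ) := by
      exact_mod_cast hgs
    have hPs' : ∑ i, ((part G i).card : ℤ) + P.card = Fintype.card O := by exact_mod_cast hPs
    have hYs' : ∑ i, ((Y.bundle i).card : ℤ) = Fintype.card O := by exact_mod_cast hYs
    calc ∑ i, min (y i) t ≤ ∑ i, y i := Finset.sum_le_sum fun i _ => min_le_left _ _
      _ ≤ ∑ i, z i := by
          simp only [y, z, Finset.sum_sub_distrib, Finset.sum_add_distrib, ← Finset.mul_sum, hd]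
          linarith
      _ = ∑ i, min (z i) t := Finset.sum_congr rfl fun i _ => (min_eq_left (ht i)).symm

end Main

theorem mainTheorem3 {n : ℕ} {O : Type*} [Fintype O] [DecidableEq O] (c : ℕ) (hc : 0 < c)
    (v : Fin n → Finset O → ℝ) (hv : ∀ i : Fin n, IsOnsub ({-1, 0, (c : ℝ)} : Set ℝ) (v i))
    (X : Allocation n O) (hX : X.IsLeximin v) :
    X.IsLorenzDominating v := by
  refine ⟨hX.1, fun Y hY k => ?_⟩
  have : NeZero n := ⟨by rintro rfl; exact k.elim0⟩
  choose r g hr hg hrg hvr using fun i => (hv i).exists_rank hc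
  obtain ⟨Z, hZ, hmax⟩ := exists_truncation_dominating hc hr hg hrg hvr
  have hlor : ∀ W : Allocation n O, W.IsComplete → ∀ k : Fin n,
      ∑ j ∈ Finset.Iic k, W.sortedUtility v j ≤ ∑ j ∈ Finset.Iic k, Z.sortedUtility v j := by
    intro W hW
    refine sum_Iic_sortAsc_le fun j => ?_
    -- Utilities are integers, so the integer thresholds of `hmax` suffice.
    have hint : W.utility v j =
        ((c * r j (W.bundle j) + g j (W.bundle j) - (W.bundle j).card : ℤ) : ℝ) := by
      simp only [Allocation.utility, hvr]
      push_cast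
      rfl
    rw [hint]
    exact hmax W hW _
  rw [← eq_of_sum_Iic_le_of_not_lexDominates (hlor X hX.1) (hX.2 Z hZ)]
  exact hlor Y hY k
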